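/- Let $I=[a,b)$ be a bounded real interval with $a<b$. Let $\mathcal D_0(I)=\{I\}$, let $\mathcal D_{k+1}(I)$ consist of the left and right halves of the intervals in $\mathcal D_k(I)$, and let $\mathcal D(I)=\bigcup_{k\ge 0}\mathcal D_k(I)$. Let $\mathfrak S_2(I)$ denote the set of all $2$-Carleson binary sequences adapted to $I$, i.e. all $\alpha=\{\alpha_J\}_{J\in\mathcal D(I)}$ with $\alpha_J\in\{0,1\}$ and $$\sup_{J\in\mathcal D(I)}\frac1{|J|}\sum_{K\in\mathcal D(J)}\alpha_K|K|\le 2 .$$ For $p\ge 1$, $\alpha\in\mathfrak S_2(I)$ and $f\in L^p(I)$ define the power-mean sparse operator $$\mathcal Q_{\alpha,p}f(t)=\sum_{J\in\mathcal D(I)}\alpha_J\,\langle |f|^p\rangle_J^{1/p}\,\mathbf 1_J(t),\qquad \langle g\rangle_J=\frac1{|J|}\int_J g(t)\,dt ,$$ with values in $[0,\infty]$, and let $\|\mathcal Q_{\alpha,p}\|_{(p,p)}=\|\mathcal Q_{\alpha,p}:L^p(I)\to L^{p,\infty}(I)\|$ be its weak-type norm, i.e. the smallest constant $c\in[0,\infty]$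 such that $$\lambda\,\big|\{t\in I:\mathcal Q_{\alpha,p}f(t)\ge\lambda\}\big|^{1/p}\le c\,\Big(\int_I|f(t)|^p\,dt\Big)^{1/p}\qquad\text{for all } f\in L^p(I)\text{ and all }\lambda>0 .$$ For $r>0$ put $C(r)=\Big(\dfrac{2^{r+1}-1}{2^r-1}\Big)^{1/r}$. Then, for every real $p\ge1$, $$\sup_{\alpha\in\mathfrak S_2(I)}\|\mathcal Q_{\alpha,p}\|_{(p,p)}=C(1/p)^{1/p}=\frac{2\cdot2^{1/p}-1}{2^{1/p}-1}.$$ -/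

import Mathlib

open MeasureTheory Set
open scoped ENNReal

noncomputable section

namespace PowerMeanSparse

/-- An interval is given by its endpoints: `J` stands for the half-open interval `[J.1, J.2)`. -/
abbrev Interval : Type := ℝ × ℝ

/-- The half-open interval `[J.1, J.2)` as a set of reals. -/
def Interval.toSet (J : Interval) : Set ℝ := Ico J.1 J.2

/-- The length `|J|`. -/
def Interval.len (J : Interval) : ℝ≥0∞ := ENNReal.ofReal (J.2 - J.1)

/-- The left half `J₋`. -/
def Interval.left (J : Interval) : Interval := (J.1, (J.1 + J.2) / 2)

/-- The right half `J₊`. -/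
def Interval.right (J : Interval) : Interval := ((J.1 + J.2) / 2, J.2)

/-- The `k`-th dyadic generation `𝒟ₖ(I)`. -/
def dyadicGen (I : Interval) : ℕ → Set Interval
  | 0 => {I}
  | k + 1 => ⋃ J ∈ dyadicGen I k, {Interval.left J, Interval.right J}

/-- The dyadic lattice `𝒟(I) = ⋃ₖ 𝒟ₖ(I)`. -/
def dyadic (I : Interval) : Set Interval := ⋃ k : ℕ, dyadicGen I k

/-- `A(α; J) = |J|⁻¹ ∑_{K ∈ 𝒟(J)} α_K |K|`. -/
def packing (α : Interval → ℕ) (J : Interval) : ℝ≥0∞ :=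
  (∑' K : dyadic J, (α K : ℝ≥0∞) * Interval.len K) / Interval.len J

/-- The set `𝔖_C(I)` of `C`-Carleson binary sequences adapted to `I`. A sequence is written as a
function on all intervals; only its values on `𝒟(I)` are ever used. -/
def carleson (C : ℝ≥0∞) (I : Interval) : Set (Interval → ℕ) :=
  {α | (∀ J ∈ dyadic I, α J = 0 ∨ α J = 1) ∧ (⨆ J ∈ dyadic I, packing α J) ≤ C}

/-- The average `⟨g⟩_J = |J|⁻¹ ∫_J g` of a function `g ≥ 0`. -/
def average (g : ℝ → ℝ≥0∞) (J : Interval) : ℝ≥0∞ :=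
  (∫⁻ t in Interval.toSet J, g t) / Interval.len J

/-- The power-mean sparse operator
`𝒬_{α,p} f (t) = ∑_{J ∈ 𝒟(I)} α_J ⟨|f|^p⟩_J^{1/p} 1_J(t)`, with values in `[0, ∞]`. -/
def powerMeanSparse (I : Interval) (α : Interval → ℕ) (p : ℝ) (f : ℝ → ℝ) (t : ℝ) : ℝ≥0∞ :=
  ∑' J : dyadic I, (α J : ℝ≥0∞) * average (fun s => ‖f s‖ₑ ^ p) J ^ (1 / p) *
    (Interval.toSet J).indicator 1 t

/-- The weak quasi-norm of `L^{p,∞}(I)`: `sup_{l > 0} l · |{t ∈ I : g(t) ≥ l}|^{1/p}`. -/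
def weakNorm (I : Interval) (p : ℝ) (g : ℝ → ℝ≥0∞) : ℝ≥0∞ :=
  ⨆ (l : ℝ) (_ : 0 < l),
    ENNReal.ofReal l * volume {t ∈ Interval.toSet I | ENNReal.ofReal l ≤ g t} ^ (1 / p)

/-- The weak-type norm `‖T : L^p(I) → L^{p,∞}(I)‖`: the optimal constant `c ∈ [0, ∞]` in
`‖T f‖_{L^{p,∞}(I)} ≤ c ‖f‖_{L^p(I)}`, `f ∈ L^p(I)`. -/
def weakTypeNorm (I : Interval) (p : ℝ) (T : (ℝ → ℝ) → ℝ → ℝ≥0∞) : ℝ≥0∞ :=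
  sInf {c : ℝ≥0∞ | ∀ f : ℝ → ℝ,
    MemLp f (ENNReal.ofReal p) (volume.restrict (Interval.toSet I)) →
      weakNorm I p (T f) ≤
        c * eLpNorm f (ENNReal.ofReal p) (volume.restrict (Interval.toSet I))}

/-- `C(r) = ((2^{r+1} - 1) / (2^r - 1))^{1/r}`. -/
def sharpConst (r : ℝ) : ℝ := (((2 : ℝ) ^ (r + 1) - 1) / ((2 : ℝ) ^ r - 1)) ^ (1 / r)

end PowerMeanSparse

end

namespace PowerMeanSparse

/-! ### The Bellman supersolution -/

/-! Upper bound: Bellman function method. With `x` the average of |f|^p, `A` the packing and `l` the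
level, the normalised size of the level set on an interval is dominated by `bellman`, the minimum of
1 and (1+g)^p (l x^{-1/p} + g A^{-1/p})^{-p}, where g = `growth p`. Three facts suffice: midpoint
concavity in (x, A), for the split into halves (`bellman_midpoint`); monotonicity under a selection,
which adds 1 to A and x^{1/p} to l (`bellman_jump`); and domination by (1+g)^p x / l^p
(`bellman_le`). Induction on the number of generations gives `volume_truncSum_le`, and monotone
limits give the full operator.

The selection inequality amounts to 1 ≤ g (A^{-1/p} - (1+A)^{-1/p}) for 0 < A ≤ 1. Its worst case A
= 1 gives g = 1/(1 - 2^{-1/p}).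

Lower bound: test on the indicator of the leftmost interval E of generation n, selecting E, its
ancestors and its two children. On E the operator equals the sum of 2^{-k/p} over k ≤ n, plus 1 from
the children; this tends to 1 + g, while the level set contains the support of f
(`chainConst_le_weakTypeNorm`). -/

/-- The harmonic-type mean `x A / (l A^{1/p} + m x^{1/p})^p = (l x^{-1/p} + m A^{-1/p})^{-p}`. -/
noncomputable def negMean (p m l x A : ℝ) : ℝ :=
  x * A / (l * A ^ (1 / p) + m * x ^ (1 / p)) ^ p

section Bellman

variable {p m l x A : ℝ}

lemma negMean_nonneg (hm : 0 ≤ m) (hl : 0 ≤ l) (hx : 0 ≤ x) (hA : 0 ≤ A) :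
    0 ≤ negMean p m l x A := by
  unfold negMean; positivity

lemma rpow_one_div_rpow (hp : 0 < p) (hx : 0 ≤ x) : (x ^ (1 / p)) ^ p = x := by
  rw [one_div, Real.rpow_inv_rpow hx hp.ne']

lemma negMean_smul (hp : 0 < p) (hm : 0 ≤ m) (hl : 0 ≤ l) {t : ℝ} (ht : 0 < t) (hx : 0 ≤ x)
    (hA : 0 ≤ A) : negMean p m l (t * x) (t * A) = t * negMean p m l x A := by
  unfold negMean
  rw [Real.mul_rpow ht.le hx, Real.mul_rpow ht.le hA,
    show l * (t ^ (1 / p) * A ^ (1 / p)) + m * (t ^ (1 / p) * x ^ (1 / p)) =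
      t ^ (1 / p) * (l * A ^ (1 / p) + m * x ^ (1 / p)) by ring,
    Real.mul_rpow (by positivity) (by positivity), rpow_one_div_rpow hp ht.le]
  rw [show t * x * (t * A) = t * (t * (x * A)) by ring, mul_div_assoc,
    mul_div_mul_left _ _ ht.ne']

lemma negMean_pos (hm : 0 < m) (hl : 0 < l) (hx : 0 < x) (hA : 0 < A) :
    0 < negMean p m l x A := by
  unfold negMean; positivity

/-- The superlevel sets of `negMean`. -/
lemma le_negMean_iff (hp : 0 < p) (hm : 0 < m) (hl : 0 < l) (hx : 0 < x) (hA : 0 < A) {t : ℝ}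
    (ht : 0 < t) : t ≤ negMean p m l x A ↔
      l * (x / t) ^ (-(1 / p)) + m * (A / t) ^ (-(1 / p)) ≤ 1 := by
  unfold negMean
  rw [le_div_iff₀ (by positivity), Real.rpow_neg (by positivity), Real.rpow_neg (by positivity),
    Real.div_rpow hx.le ht.le, Real.div_rpow hA.le ht.le]
  have hX : 0 < x ^ (1 / p) := by positivity
  have hB : 0 < A ^ (1 / p) := by positivity
  have hT : 0 < t ^ (1 / p) := by positivity
  -- Everything is written as a p-th power, so that the comparison reduces to p-th roots.
  rw [← rpow_one_div_rpow hp hx.le, ← rpow_one_div_rpow hp hA.le, ← rpow_one_div_rpow hp ht.le,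
    ← Real.mul_rpow (by positivity) (by positivity),
    ← Real.mul_rpow (by positivity) (by positivity)]
  simp only [rpow_one_div_rpow hp hx.le, rpow_one_div_rpow hp hA.le, rpow_one_div_rpow hp ht.le]
  rw [Real.rpow_le_rpow_iff (by positivity) (by positivity) hp, ← sub_nonneg,
    ← sub_nonneg (b := _ + _)]
  have : 1 - (l * (x ^ (1 / p) / t ^ (1 / p))⁻¹ + m * (A ^ (1 / p) / t ^ (1 / p))⁻¹) =
      (x ^ (1 / p) * A ^ (1 / p) - t ^ (1 / p) * (l * A ^ (1 / p) + m * x ^ (1 / p))) /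
        (x ^ (1 / p) * A ^ (1 / p)) := by
    field_simp
  rw [this, le_div_iff₀ (by positivity), zero_mul]

lemma negMean_le_of_le (hp : 0 < p) (hm : 0 < m) (hl : 0 < l) (hx : 0 < x) (hA : 0 < A)
    {y B : ℝ} (hxy : x ≤ y) (hAB : A ≤ B) : negMean p m l x A ≤ negMean p m l y B := by
  have hy := hx.trans_le hxy
  have hB := hA.trans_le hAB
  have h := negMean_pos (p := p) hm hl hx hA
  have h1 := (le_negMean_iff hp hm hl hx hA h).1 le_rfl
  refine (le_negMean_iff hp hm hl hy hB h).2 (le_trans ?_ h1)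
  have hr : -(1 / p) ≤ 0 := by simp [hp.le]
  gcongr l * ?_ + m * ?_
  · exact Real.rpow_le_rpow_of_nonpos (by positivity) (by gcongr) hr
  · exact Real.rpow_le_rpow_of_nonpos (by positivity) (by gcongr) hr

/-- Convexity of a nonpositive power: concavity of `log`, reversed by the sign of `s`, followed by
convexity of `exp`. -/
lemma rpow_convexCombo_le {s x y a b : ℝ} (hs : s ≤ 0) (hx : 0 < x) (hy : 0 < y) (ha : 0 < a)
    (hb : 0 < b) (hab : a + b = 1) : (a * x + b * y) ^ s ≤ a * x ^ s + b * y ^ s := by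
  rw [Real.rpow_def_of_pos hx, Real.rpow_def_of_pos hy, Real.rpow_def_of_pos (by positivity)]
  have h1 : a * Real.log x + b * Real.log y ≤ Real.log (a * x + b * y) :=
    strictConcaveOn_log_Ioi.concaveOn.2 hx hy ha.le hb.le hab
  have h2 : Real.exp (a * (Real.log x * s) + b * (Real.log y * s)) ≤
      a * Real.exp (Real.log x * s) + b * Real.exp (Real.log y * s) :=
    convexOn_exp.2 (mem_univ _) (mem_univ _) ha.le hb.le hab
  refine le_trans (Real.exp_le_exp.2 ?_) h2
  linarith [mul_le_mul_of_nonpos_right h1 hs]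

/-- By `le_negMean_iff` the superlevel sets are sublevel sets of a convex function of (x/t, A/t).
For a function homogeneous of degree one this convexity is superadditivity. -/
lemma negMean_add_le_of_pos (hp : 0 < p) (hm : 0 < m) (hl : 0 < l) {x A y B : ℝ} (hx : 0 < x)
    (hA : 0 < A) (hy : 0 < y) (hB : 0 < B) :
    negMean p m l x A + negMean p m l y B ≤ negMean p m l (x + y) (A + B) := by
  have hs := negMean_pos (p := p) hm hl hx hA
  have ht := negMean_pos (p := p) hm hl hy hB
  have h1 := (le_negMean_iff hp hm hl hx hA hs).1 le_rfl
  have h2 := (le_negMean_iff hp hm hl hy hB ht).1 le_rfl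
  set s := negMean p m l x A
  set t := negMean p m l y B
  refine (le_negMean_iff hp hm hl (by positivity) (by positivity) (by positivity)).2 ?_
  have hr : -(1 / p) < 0 := by simp [hp]
  -- (u+v)/(s+t) is the average of u/s and v/t with weights s/(s+t) and t/(s+t).
  have hc : ∀ u v : ℝ, 0 < u → 0 < v → ((u + v) / (s + t)) ^ (-(1 / p)) ≤
      s / (s + t) * (u / s) ^ (-(1 / p)) + t / (s + t) * (v / t) ^ (-(1 / p)) := by
    intro u v hu hv
    have := rpow_convexCombo_le hr.le (x := u / s) (y := v / t) (a := s / (s + t))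
      (b := t / (s + t)) (by positivity) (by positivity)
      (by positivity) (by positivity) (by field_simp)
    refine le_trans (le_of_eq ?_) this
    congr 1
    field_simp
  calc _ ≤ l * (s / (s + t) * (x / s) ^ (-(1 / p)) + t / (s + t) * (y / t) ^ (-(1 / p))) +
        m * (s / (s + t) * (A / s) ^ (-(1 / p)) + t / (s + t) * (B / t) ^ (-(1 / p))) := by
        gcongr
        · exact hc x y hx hy
        · exact hc A B hA hB
    _ = s / (s + t) * (l * (x / s) ^ (-(1 / p)) + m * (A / s) ^ (-(1 / p))) +
        t / (s + t) * (l * (y / t) ^ (-(1 / p)) + m * (B / t) ^ (-(1 / p))) := by ring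
    _ ≤ s / (s + t) * 1 + t / (s + t) * 1 := by gcongr
    _ = 1 := by field_simp

lemma negMean_of_mul_eq_zero (h : x * A = 0) : negMean p m l x A = 0 := by
  simp [negMean, h]

lemma negMean_le_add (hp : 0 < p) (hm : 0 < m) (hl : 0 < l) {x A y B : ℝ} (hx : 0 ≤ x)
    (hA : 0 ≤ A) (hy : 0 ≤ y) (hB : 0 ≤ B) :
    negMean p m l x A ≤ negMean p m l (x + y) (A + B) := by
  rcases eq_or_ne (x * A) 0 with h | h
  · rw [negMean_of_mul_eq_zero h]
    exact negMean_nonneg hm.le hl.le (by positivity) (by positivity)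
  · have hx' := hx.lt_of_ne' (left_ne_zero_of_mul h)
    have hA' := hA.lt_of_ne' (right_ne_zero_of_mul h)
    exact negMean_le_of_le hp hm hl hx' hA' (by linarith) (by linarith)

lemma negMean_add_le (hp : 0 < p) (hm : 0 < m) (hl : 0 < l) {x A y B : ℝ} (hx : 0 ≤ x)
    (hA : 0 ≤ A) (hy : 0 ≤ y) (hB : 0 ≤ B) :
    negMean p m l x A + negMean p m l y B ≤ negMean p m l (x + y) (A + B) := by
  rcases eq_or_ne (x * A) 0 with h | h
  · rw [negMean_of_mul_eq_zero h, zero_add, add_comm x, add_comm A]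
    exact negMean_le_add hp hm hl hy hB hx hA
  rcases eq_or_ne (y * B) 0 with hyB | hyB
  · rw [negMean_of_mul_eq_zero hyB, add_zero]
    exact negMean_le_add hp hm hl hx hA hy hB
  · exact negMean_add_le_of_pos hp hm hl (hx.lt_of_ne' (left_ne_zero_of_mul h))
      (hA.lt_of_ne' (right_ne_zero_of_mul h)) (hy.lt_of_ne' (left_ne_zero_of_mul hyB))
      (hB.lt_of_ne' (right_ne_zero_of_mul hyB))

/-- The constant `2^{1/p} / (2^{1/p} - 1)`; the sharp constant is `1 + growth p`. -/
noncomputable def growth (p : ℝ) : ℝ := 2 ^ (1 / p) / (2 ^ (1 / p) - 1)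

lemma one_lt_two_rpow (hp : 0 < p) : (1 : ℝ) < 2 ^ (1 / p) :=
  Real.one_lt_rpow (by norm_num) (by positivity)

lemma growth_pos (hp : 0 < p) : 0 < growth p :=
  div_pos (by positivity) (by linarith [one_lt_two_rpow hp])

/-- A supersolution of the Bellman recursion for the level sets of `powerMeanSparse`: it bounds
the proportion of `J` on which the operator is at least `l`, where `x = ⟨|f|^p⟩_J` and `A` is the
packing of `J`. -/
noncomputable def bellman (p x A l : ℝ) : ℝ :=
  if l ≤ 0 then 1 else min 1 ((1 + growth p) ^ p * negMean p (growth p) l x A)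

lemma bellman_of_nonpos (hl : l ≤ 0) : bellman p x A l = 1 := if_pos hl

lemma bellman_of_pos (hl : 0 < l) :
    bellman p x A l = min 1 ((1 + growth p) ^ p * negMean p (growth p) l x A) :=
  if_neg hl.not_ge

lemma bellman_le_one : bellman p x A l ≤ 1 := by
  unfold bellman; split_ifs <;> simp

lemma bellman_nonneg (hp : 0 < p) (hx : 0 ≤ x) (hA : 0 ≤ A) : 0 ≤ bellman p x A l := by
  have := growth_pos hp
  rcases le_or_gt l 0 with h | h
  · rw [bellman_of_nonpos h]; exact zero_le_one
  · rw [bellman_of_pos h]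
    exact le_min zero_le_one
      (mul_nonneg (by positivity) (negMean_nonneg this.le h.le hx hA))

/-- Homogeneity turns superadditivity of `negMean` into midpoint concavity, and truncation at 1
preserves it. -/
lemma bellman_midpoint (hp : 0 < p) {x A y B : ℝ} (hx : 0 ≤ x) (hA : 0 ≤ A) (hy : 0 ≤ y)
    (hB : 0 ≤ B) :
    (bellman p x A l + bellman p y B l) / 2 ≤ bellman p ((x + y) / 2) ((A + B) / 2) l := by
  rcases le_or_gt l 0 with h | h
  · simp [bellman_of_nonpos h]
  have hg := growth_pos hp
  rw [bellman_of_pos (x := (x + y) / 2) h]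
  refine le_min ?_ ?_
  · linarith [bellman_le_one (p := p) (x := x) (A := A) (l := l),
      bellman_le_one (p := p) (x := y) (A := B) (l := l)]
  · rw [bellman_of_pos h, bellman_of_pos h]
    have h1 := negMean_add_le hp hg h hx hA hy hB
    have h2 := negMean_smul hp hg.le h.le (t := 1 / 2) (by norm_num) (add_nonneg hx hy)
      (add_nonneg hA hB)
    rw [show (x + y) / 2 = 1 / 2 * (x + y) by ring, show (A + B) / 2 = 1 / 2 * (A + B) by ring, h2]
    have h3 := min_le_right 1 ((1 + growth p) ^ p * negMean p (growth p) l x A)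
    have h4 := min_le_right 1 ((1 + growth p) ^ p * negMean p (growth p) l y B)
    have h5 := mul_le_mul_of_nonneg_left h1 (show 0 ≤ (1 + growth p) ^ p by positivity)
    linarith

/-- The increment of the concave power 1/p over [A, A+1] is at least that over [1, 2], while the
left side is at most its value at A = 1. Equality at A = 1 is what fixes `growth`. -/
lemma rpow_mul_rpow_le_growth (hp : 1 ≤ p) (hA : 0 ≤ A) (hA1 : A ≤ 1) :
    A ^ (1 / p) * (1 + A) ^ (1 / p) ≤ growth p * ((1 + A) ^ (1 / p) - A ^ (1 / p)) := by
  have hp0 : 0 < p := by linarith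
  have hr0 : 0 ≤ 1 / p := by positivity
  have hr1 : 1 / p ≤ 1 := (div_le_one hp0).2 hp
  have hconc := Real.concaveOn_rpow hr0 hr1
  have h2A : 0 < 2 - A := by linarith
  have e1 : ∀ w : ℝ, 0 ≤ w → w ≤ 1 →
      w * A ^ (1 / p) + (1 - w) * 2 ^ (1 / p) ≤ (w * A + (1 - w) * 2) ^ (1 / p) := by
    intro w hw hw1
    have h2 : (2 : ℝ) ∈ Ici 0 := by simp
    simpa using hconc.2 hA h2 hw (sub_nonneg.2 hw1) (by ring)
  -- The points 1 and 1 + A lie between A and 2 with complementary weights, so the two concavity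
  -- bounds add up to A^{1/p} + 2^{1/p} ≤ 1 + (1+A)^{1/p}.
  have f1 := e1 (1 / (2 - A)) (by positivity) ((div_le_one h2A).2 (by linarith))
  have f2 := e1 (1 - 1 / (2 - A)) (sub_nonneg.2 ((div_le_one h2A).2 (by linarith)))
    (by have : 0 ≤ 1 / (2 - A) := by positivity
        linarith)
  rw [show 1 / (2 - A) * A + (1 - 1 / (2 - A)) * 2 = 1 by field_simp; ring, Real.one_rpow] at f1
  rw [show (1 - 1 / (2 - A)) * A + (1 - (1 - 1 / (2 - A))) * 2 = 1 + A by field_simp; ring] at f2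
  have hd : 2 ^ (1 / p) - 1 ≤ (1 + A) ^ (1 / p) - A ^ (1 / p) := by linarith
  have h2 := one_lt_two_rpow hp0
  calc A ^ (1 / p) * (1 + A) ^ (1 / p) ≤ 1 * 2 ^ (1 / p) := by
        gcongr
        · exact Real.rpow_le_one hA hA1 hr0
        · linarith
    _ = growth p * (2 ^ (1 / p) - 1) := by
        unfold growth
        rw [div_mul_cancel₀ _ (by linarith), one_mul]
    _ ≤ _ := mul_le_mul_of_nonneg_left hd (growth_pos hp0).le

/-- A single selection already reaches the level here. The factor (1+g)^p is chosen so that the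
bound equals 1 in the extreme case A = 1, l = x^{1/p}. -/
lemma one_le_mul_negMean (hp : 0 < p) (hx : 0 ≤ x) (hA : 1 ≤ A) (hl : 0 < l)
    (h : l ≤ x ^ (1 / p)) : 1 ≤ (1 + growth p) ^ p * negMean p (growth p) l x A := by
  have hg := growth_pos hp
  have hx' : 0 < x := hx.lt_of_ne' (by
    rintro rfl
    rw [Real.zero_rpow (by positivity)] at h
    linarith)
  have hA0 : 0 < A := by linarith
  have hA1 : 1 ≤ A ^ (1 / p) := Real.one_le_rpow hA (by positivity)
  unfold negMean
  rw [← mul_div_assoc, le_div_iff₀ (by positivity), one_mul]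
  calc (l * A ^ (1 / p) + growth p * x ^ (1 / p)) ^ p
      ≤ ((1 + growth p) * (x ^ (1 / p) * A ^ (1 / p))) ^ p := by
        gcongr
        have h1 : l * A ^ (1 / p) ≤ x ^ (1 / p) * A ^ (1 / p) := by gcongr
        have h2 : growth p * (x ^ (1 / p) * 1) ≤ growth p * (x ^ (1 / p) * A ^ (1 / p)) := by
          gcongr
        linarith
    _ = (1 + growth p) ^ p * (x * A) := by
        rw [Real.mul_rpow (by positivity) (by positivity),
          Real.mul_rpow (by positivity) (by positivity), rpow_one_div_rpow hp hx,
          rpow_one_div_rpow hp hA0.le]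

/-- A selection raises l x^{-1/p} by exactly 1, and the fall of g A^{-1/p} compensates for this by
`rpow_mul_rpow_le_growth`. -/
lemma negMean_jump (hp : 1 ≤ p) (hx : 0 ≤ x) (hA : 0 ≤ A) (hA1 : A ≤ 1) (hl : 0 < l) :
    negMean p (growth p) l x A ≤ negMean p (growth p) (l + x ^ (1 / p)) x (1 + A) := by
  have hp0 : 0 < p := by linarith
  have hg := growth_pos hp0
  rcases eq_or_ne (x * A) 0 with h | h
  · rw [negMean_of_mul_eq_zero h]
    exact negMean_nonneg hg.le (by positivity) hx (by positivity)
  have hx' := hx.lt_of_ne' (left_ne_zero_of_mul h)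
  have hA' := hA.lt_of_ne' (right_ne_zero_of_mul h)
  unfold negMean
  rw [div_le_div_iff₀ (by positivity) (by positivity), mul_assoc, mul_assoc]
  refine mul_le_mul_of_nonneg_left ?_ hx
  have key := rpow_mul_rpow_le_growth hp hA hA1
  calc A * ((l + x ^ (1 / p)) * (1 + A) ^ (1 / p) + growth p * x ^ (1 / p)) ^ p
      = (A ^ (1 / p) * ((l + x ^ (1 / p)) * (1 + A) ^ (1 / p) + growth p * x ^ (1 / p))) ^ p := by
        rw [Real.mul_rpow (by positivity) (by positivity), rpow_one_div_rpow hp0 hA]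
    _ ≤ ((1 + A) ^ (1 / p) * (l * A ^ (1 / p) + growth p * x ^ (1 / p))) ^ p := by
        refine Real.rpow_le_rpow (by positivity) ?_ hp0.le
        have := mul_le_mul_of_nonneg_left key (show 0 ≤ x ^ (1 / p) by positivity)
        linarith
    _ = _ := by
        rw [Real.mul_rpow (by positivity) (by positivity), rpow_one_div_rpow hp0 (by positivity)]

lemma bellman_jump (hp : 1 ≤ p) (hx : 0 ≤ x) (hA : 0 ≤ A) (hA1 : A ≤ 1) :
    bellman p x A (l - x ^ (1 / p)) ≤ bellman p x (1 + A) l := by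
  have hp0 : 0 < p := by linarith
  have hg := growth_pos hp0
  rcases le_or_gt l 0 with h | h
  · rw [bellman_of_nonpos h]; exact bellman_le_one
  rw [bellman_of_pos h]
  rcases le_or_gt l (x ^ (1 / p)) with h' | h'
  · rw [min_eq_left (one_le_mul_negMean hp0 hx (by linarith) h h')]
    exact bellman_le_one
  · rw [bellman_of_pos (sub_pos.2 h')]
    have := negMean_jump hp hx hA hA1 (sub_pos.2 h')
    rw [sub_add_cancel] at this
    gcongr

lemma bellman_le (hp : 0 < p) (hx : 0 ≤ x) (hA : 0 ≤ A) (hl : 0 < l) :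
    bellman p x A l ≤ (1 + growth p) ^ p * x / l ^ p := by
  have hg := growth_pos hp
  rw [bellman_of_pos hl, mul_div_assoc]
  refine (min_le_right _ _).trans (mul_le_mul_of_nonneg_left ?_ (by positivity))
  rcases hA.eq_or_lt with rfl | hA
  · rw [negMean_of_mul_eq_zero (mul_zero x)]
    positivity
  unfold negMean
  rw [div_le_div_iff₀ (by positivity) (by positivity), mul_assoc]
  refine mul_le_mul_of_nonneg_left ?_ hx
  calc A * l ^ p = (l * A ^ (1 / p)) ^ p := by
        rw [Real.mul_rpow (by positivity) (by positivity), rpow_one_div_rpow hp hA.le, mul_comm]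
    _ ≤ _ := by
        gcongr
        have : 0 ≤ growth p * x ^ (1 / p) := by positivity
        linarith

end Bellman

/-! ### Structure of the dyadic lattice -/

/-- The definition subdivides the last generation; splitting at the root instead is what the
inductions on subtrees need. -/
lemma dyadicGen_succ_eq (J : Interval) (k : ℕ) :
    dyadicGen J (k + 1) =
      dyadicGen (Interval.left J) k ∪ dyadicGen (Interval.right J) k := by
  induction k with
  | zero => ext K; simp [dyadicGen, or_comm]
  | succ k ih =>
    rw [dyadicGen, ih, biUnion_union]
    rfl

lemma dyadic_eq (J : Interval) :
    dyadic J = {J} ∪ (dyadic (Interval.left J) ∪ dyadic (Interval.right J)) := by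
  unfold dyadic
  rw [← iUnion_union_distrib, ← union_iUnion_nat_succ]
  simp only [dyadicGen_succ_eq]
  rfl

lemma self_mem_dyadic (J : Interval) : J ∈ dyadic J := by
  rw [dyadic_eq]; simp

lemma dyadic_left_subset (J : Interval) : dyadic (Interval.left J) ⊆ dyadic J := by
  rw [dyadic_eq J]; exact fun K hK => Or.inr (Or.inl hK)

lemma dyadic_right_subset (J : Interval) : dyadic (Interval.right J) ⊆ dyadic J := by
  rw [dyadic_eq J]; exact fun K hK => Or.inr (Or.inr hK)

/-- Induction along the dyadic lattice, from the root to its descendants. -/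
lemma dyadic_induction {I : Interval} {P : Interval → Prop} (h0 : P I)
    (hl : ∀ J ∈ dyadic I, P J → P (Interval.left J))
    (hr : ∀ J ∈ dyadic I, P J → P (Interval.right J)) {J : Interval} (hJ : J ∈ dyadic I) :
    P J := by
  obtain ⟨k, hk⟩ := mem_iUnion.1 hJ
  clear hJ
  induction k generalizing J with
  | zero => rwa [show J = I from hk]
  | succ k ih =>
    obtain ⟨K, hK, rfl | rfl⟩ := mem_iUnion₂.1 hk
    · exact hl K (mem_iUnion.2 ⟨k, hK⟩) (ih hK)
    · exact hr K (mem_iUnion.2 ⟨k, hK⟩) (ih hK)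

lemma dyadic_subset {I J : Interval} (hJ : J ∈ dyadic I) : dyadic J ⊆ dyadic I :=
  dyadic_induction (P := fun J => dyadic J ⊆ dyadic I) subset_rfl
    (fun J _ h => (dyadic_left_subset J).trans h) (fun J _ h => (dyadic_right_subset J).trans h) hJ

lemma dyadic_bounds {I J : Interval} (hI : I.1 < I.2) (hJ : J ∈ dyadic I) :
    I.1 ≤ J.1 ∧ J.1 < J.2 ∧ J.2 ≤ I.2 := by
  refine dyadic_induction (P := fun J => I.1 ≤ J.1 ∧ J.1 < J.2 ∧ J.2 ≤ I.2)
    ⟨le_rfl, hI, le_rfl⟩ ?_ ?_ hJ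
  · rintro J - ⟨h1, h2, h3⟩
    simp only [Interval.left]
    exact ⟨h1, by linarith, by linarith⟩
  · rintro J - ⟨h1, h2, h3⟩
    simp only [Interval.right]
    exact ⟨by linarith, by linarith, h3⟩

lemma left_lt {J : Interval} (hJ : J.1 < J.2) : (Interval.left J).1 < (Interval.left J).2 :=
  (dyadic_bounds hJ (dyadic_left_subset J (self_mem_dyadic _))).2.1

lemma right_lt {J : Interval} (hJ : J.1 < J.2) : (Interval.right J).1 < (Interval.right J).2 :=
  (dyadic_bounds hJ (dyadic_right_subset J (self_mem_dyadic _))).2.1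

lemma toSet_subset {I J : Interval} (hI : I.1 < I.2) (hJ : J ∈ dyadic I) :
    Interval.toSet J ⊆ Interval.toSet I :=
  Ico_subset_Ico (dyadic_bounds hI hJ).1 (dyadic_bounds hI hJ).2.2

lemma toSet_left_union_right {J : Interval} (hJ : J.1 < J.2) :
    Interval.toSet (Interval.left J) ∪ Interval.toSet (Interval.right J) = Interval.toSet J :=
  Ico_union_Ico_eq_Ico (left_lt hJ).le (right_lt hJ).le

lemma disjoint_toSet_left_right (J : Interval) :
    Disjoint (Interval.toSet (Interval.left J)) (Interval.toSet (Interval.right J)) :=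
  Ico_disjoint_Ico_same

lemma measurableSet_toSet (J : Interval) : MeasurableSet (Interval.toSet J) := measurableSet_Ico

lemma not_mem_dyadic_left {J : Interval} (hJ : J.1 < J.2) : J ∉ dyadic (Interval.left J) := by
  intro h
  have := (dyadic_bounds (left_lt hJ) h).2.2
  simp only [Interval.left] at this
  linarith

lemma not_mem_dyadic_right {J : Interval} (hJ : J.1 < J.2) : J ∉ dyadic (Interval.right J) := by
  intro h
  have := (dyadic_bounds (right_lt hJ) h).1
  simp only [Interval.right] at this
  linarith

lemma disjoint_dyadic_left_right {J : Interval} (hJ : J.1 < J.2) :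
    Disjoint (dyadic (Interval.left J)) (dyadic (Interval.right J)) := by
  refine disjoint_left.2 fun K h1 h2 => ?_
  have a := dyadic_bounds (left_lt hJ) h1
  have b := dyadic_bounds (right_lt hJ) h2
  simp only [Interval.left, Interval.right] at a b
  linarith

lemma len_left (J : Interval) : Interval.len (Interval.left J) = Interval.len J / 2 := by
  simp only [Interval.len, Interval.left]
  rw [show (J.1 + J.2) / 2 - J.1 = (J.2 - J.1) / 2 by ring, ENNReal.ofReal_div_of_pos two_pos,
    ENNReal.ofReal_ofNat]

lemma len_right (J : Interval) : Interval.len (Interval.right J) = Interval.len J / 2 := by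
  simp only [Interval.len, Interval.right]
  rw [show J.2 - (J.1 + J.2) / 2 = (J.2 - J.1) / 2 by ring, ENNReal.ofReal_div_of_pos two_pos,
    ENNReal.ofReal_ofNat]

lemma len_ne_zero {J : Interval} (hJ : J.1 < J.2) : Interval.len J ≠ 0 := by
  simpa [Interval.len] using hJ

lemma len_ne_top (J : Interval) : Interval.len J ≠ ∞ := ENNReal.ofReal_ne_top

/-! ### Sums over the dyadic lattice -/

lemma tsum_dyadic (h : Interval → ℝ≥0∞) {J : Interval} (hJ : J.1 < J.2) :
    ∑' K : dyadic J, h K = h J +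
      (∑' K : dyadic (Interval.left J), h K + ∑' K : dyadic (Interval.right J), h K) := by
  rw [dyadic_eq J, ENNReal.summable.tsum_union_disjoint _ ENNReal.summable,
    ENNReal.summable.tsum_union_disjoint (disjoint_dyadic_left_right hJ) ENNReal.summable,
    tsum_singleton]
  rw [disjoint_singleton_left]
  rintro (h | h)
  exacts [not_mem_dyadic_left hJ h, not_mem_dyadic_right hJ h]

/-- The sum of `h` over the first `n` generations of `𝒟(J)`. -/
noncomputable def truncSum (h : Interval → ℝ≥0∞) : ℕ → Interval → ℝ≥0∞
  | 0, _ => 0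
  | n + 1, J => h J + (truncSum h n (Interval.left J) + truncSum h n (Interval.right J))

lemma truncSum_le_tsum (h : Interval → ℝ≥0∞) (n : ℕ) {J : Interval} (hJ : J.1 < J.2) :
    truncSum h n J ≤ ∑' K : dyadic J, h K := by
  induction n generalizing J with
  | zero => exact zero_le
  | succ n ih =>
    rw [tsum_dyadic h hJ, truncSum]
    gcongr
    exacts [ih (left_lt hJ), ih (right_lt hJ)]

lemma truncSum_mono (h : Interval → ℝ≥0∞) (J : Interval) : Monotone fun n => truncSum h n J := by
  refine monotone_nat_of_le_succ fun n => ?_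
  induction n generalizing J with
  | zero => exact zero_le
  | succ n ih =>
    rw [truncSum, truncSum]
    gcongr
    exacts [ih _, ih _]

lemma sum_tsum_dyadicGen_le (h : Interval → ℝ≥0∞) (n : ℕ) (J : Interval) :
    ∑ k ∈ Finset.range n, ∑' K : dyadicGen J k, h K ≤ truncSum h n J := by
  induction n generalizing J with
  | zero => simp
  | succ n ih =>
    rw [Finset.sum_range_succ', truncSum, add_comm]
    refine add_le_add (le_of_eq (tsum_singleton J h)) ?_
    refine le_trans (Finset.sum_le_sum fun k _ => ?_)
      (Finset.sum_add_distrib.trans_le (add_le_add (ih _) (ih _)))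
    rw [dyadicGen_succ_eq]
    exact ENNReal.tsum_union_le _ _ _

lemma tsum_dyadic_le_iSup (h : Interval → ℝ≥0∞) (J : Interval) :
    ∑' K : dyadic J, h K ≤ ⨆ n, truncSum h n J := by
  refine (ENNReal.tsum_iUnion_le_tsum h (dyadicGen J)).trans ?_
  rw [ENNReal.tsum_eq_iSup_nat]
  exact iSup_mono fun n => sum_tsum_dyadicGen_le h n J

lemma truncSum_eq_zero {h : Interval → ℝ≥0∞} (n : ℕ) {J : Interval}
    (hh : ∀ K ∈ dyadic J, h K = 0) : truncSum h n J = 0 := by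
  induction n generalizing J with
  | zero => rfl
  | succ n ih =>
    rw [truncSum, hh J (self_mem_dyadic J), ih fun K hK => hh K (dyadic_left_subset J hK),
      ih fun K hK => hh K (dyadic_right_subset J hK)]
    simp

/-- The packing of `J` by the first `n` generations, as a real number. -/
noncomputable def truncPacking (α : Interval → ℕ) : ℕ → Interval → ℝ
  | 0, _ => 0
  | n + 1, J =>
    α J + (truncPacking α n (Interval.left J) + truncPacking α n (Interval.right J)) / 2

lemma truncPacking_nonneg (α : Interval → ℕ) (n : ℕ) (J : Interval) :
    0 ≤ truncPacking α n J := by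
  induction n generalizing J with
  | zero => exact le_rfl
  | succ n ih =>
    have h1 := ih (Interval.left J)
    have h2 := ih (Interval.right J)
    rw [truncPacking]
    positivity

lemma ofReal_truncPacking_mul_len (α : Interval → ℕ) (n : ℕ) {J : Interval} (hJ : J.1 < J.2) :
    ENNReal.ofReal (truncPacking α n J * (J.2 - J.1)) =
      truncSum (fun K => (α K : ℝ≥0∞) * Interval.len K) n J := by
  induction n generalizing J with
  | zero => simp [truncPacking, truncSum]
  | succ n ih =>
    have hd : 0 ≤ J.2 - J.1 := by linarith
    have h1 := truncPacking_nonneg α n (Interval.left J)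
    have h2 := truncPacking_nonneg α n (Interval.right J)
    rw [truncSum, ← ih (left_lt hJ), ← ih (right_lt hJ), truncPacking, Interval.len,
      ← ENNReal.ofReal_natCast, ← ENNReal.ofReal_mul (by positivity),
      show (Interval.left J).2 - (Interval.left J).1 = (J.2 - J.1) / 2 by
        simp only [Interval.left]; ring,
      show (Interval.right J).2 - (Interval.right J).1 = (J.2 - J.1) / 2 by
        simp only [Interval.right]; ring,
      ← ENNReal.ofReal_add (by positivity) (by positivity),
      ← ENNReal.ofReal_add (by positivity) (by positivity)]
    congr 1
    ring

lemma packing_le_iff {α : Interval → ℕ} {J : Interval} (hJ : J.1 < J.2) {C : ℝ≥0∞} :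
    packing α J ≤ C ↔ ∑' K : dyadic J, (α K : ℝ≥0∞) * Interval.len K ≤ C * Interval.len J :=
  ENNReal.div_le_iff (len_ne_zero hJ) (len_ne_top J)

lemma truncPacking_le_two {α : Interval → ℕ} {J : Interval} (hJ : J.1 < J.2)
    (h : packing α J ≤ 2) (n : ℕ) : truncPacking α n J ≤ 2 := by
  have hd : 0 < J.2 - J.1 := by linarith
  have h1 := (truncSum_le_tsum (fun K => (α K : ℝ≥0∞) * Interval.len K) n hJ).trans
    ((packing_le_iff hJ).1 h)
  rw [← ofReal_truncPacking_mul_len α n hJ, Interval.len, ← ENNReal.ofReal_ofNat,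
    ← ENNReal.ofReal_mul (by norm_num), ENNReal.ofReal_le_ofReal_iff (by positivity)] at h1
  exact le_of_mul_le_mul_right h1 hd

/-! ### The upper bound -/

/-- The Carleson constant 2 enters here: when the interval is selected, it leaves A ≤ 1 for the two
halves, the range in which `bellman_jump` holds. -/
lemma bellman_step {p l x A : ℝ} (hp : 1 ≤ p) {ε : ℕ} (hε : ε = 0 ∨ ε = 1) (hx : 0 ≤ x)
    (hA : 0 ≤ A) (hA2 : ε + A ≤ 2) :
    bellman p x A (l - ε * x ^ (1 / p)) ≤ bellman p x (ε + A) l := by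
  rcases hε with rfl | rfl
  · simp
  · have := bellman_jump (l := l) hp hx hA (by push_cast at hA2; linarith)
    simpa using this

/-- The distribution of the truncated operator is controlled by the Bellman supersolution. -/
lemma volume_truncSum_le {p : ℝ} (hp : 1 ≤ p) (α : Interval → ℕ) (x : Interval → ℝ)
    (hx : ∀ J, 0 ≤ x J) (n : ℕ) {J : Interval} (hJ : J.1 < J.2)
    (hα : ∀ K ∈ dyadic J, α K = 0 ∨ α K = 1) (hα2 : ∀ K ∈ dyadic J, packing α K ≤ 2)
    (hmid : ∀ K ∈ dyadic J, x K = (x (Interval.left K) + x (Interval.right K)) / 2) (l : ℝ) :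
    volume {t ∈ Interval.toSet J | ENNReal.ofReal l ≤ truncSum (fun K =>
      (α K : ℝ≥0∞) * ENNReal.ofReal (x K) ^ (1 / p) * (Interval.toSet K).indicator 1 t) n J} ≤
      ENNReal.ofReal ((J.2 - J.1) * bellman p (x J) (truncPacking α n J) l) := by
  have hp0 : 0 < p := by linarith
  induction n generalizing J l with
  | zero =>
    rcases le_or_gt l 0 with h | h
    · rw [bellman_of_nonpos h, mul_one]
      refine (measure_mono (sep_subset _ _)).trans (le_of_eq ?_)
      exact Real.volume_Ico
    · refine le_of_eq_of_le ?_ zero_le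
      simp [truncSum, h.not_ge]
  | succ n ih =>
    set h : ℝ → Interval → ℝ≥0∞ := fun t K =>
      (α K : ℝ≥0∞) * ENNReal.ofReal (x K) ^ (1 / p) * (Interval.toSet K).indicator 1 t with hh
    have hlsub := dyadic_left_subset J
    have hrsub := dyadic_right_subset J
    have ihl := ih (left_lt hJ) (fun K hK => hα K (hlsub hK)) (fun K hK => hα2 K (hlsub hK))
      (fun K hK => hmid K (hlsub hK)) (l - α J * x J ^ (1 / p))
    have ihr := ih (right_lt hJ) (fun K hK => hα K (hrsub hK)) (fun K hK => hα2 K (hrsub hK))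
      (fun K hK => hmid K (hrsub hK)) (l - α J * x J ^ (1 / p))
    have hz : ∀ t (K : Interval), K.1 < K.2 → t ∉ Interval.toSet K → truncSum (h t) n K = 0 := by
      intro t K hK ht
      refine truncSum_eq_zero n fun K' hK' => ?_
      simp only [hh]
      rw [indicator_of_notMem fun h' => ht (toSet_subset hK hK' h'), mul_zero]
    have hjump : ∀ t ∈ Interval.toSet J, h t J = ENNReal.ofReal (α J * x J ^ (1 / p)) := by
      intro t ht
      simp only [hh]
      rw [indicator_of_mem ht, Pi.one_apply, mul_one, ENNReal.ofReal_mul (by positivity),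
        ENNReal.ofReal_natCast, ENNReal.ofReal_rpow_of_nonneg (hx J) (by positivity)]
    -- If the reduced level is negative, `ENNReal.ofReal` sends it to 0 and the condition becomes
    -- void; this agrees with `bellman` being 1 there.
    have hlevel : ∀ t ∈ Interval.toSet J, ∀ S : ℝ≥0∞, ENNReal.ofReal l ≤ h t J + S →
        ENNReal.ofReal (l - α J * x J ^ (1 / p)) ≤ S := by
      intro t ht S hS
      have := hx J
      rw [ENNReal.ofReal_sub _ (by positivity)]
      exact tsub_le_iff_left.2 (hjump t ht ▸ hS)
    have hsub : {t ∈ Interval.toSet J | ENNReal.ofReal l ≤ truncSum (h t) (n + 1) J} ⊆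
        {t ∈ Interval.toSet (Interval.left J) | ENNReal.ofReal (l - α J * x J ^ (1 / p)) ≤
          truncSum (h t) n (Interval.left J)} ∪
        {t ∈ Interval.toSet (Interval.right J) | ENNReal.ofReal (l - α J * x J ^ (1 / p)) ≤
          truncSum (h t) n (Interval.right J)} := by
      rintro t ⟨ht, hS⟩
      rw [truncSum] at hS
      have hS' := hlevel t ht _ hS
      rcases (toSet_left_union_right hJ).symm ▸ ht with h1 | h1
      · refine Or.inl ⟨h1, ?_⟩
        rwa [hz t _ (right_lt hJ) (disjoint_left.1 (disjoint_toSet_left_right J) h1),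
          add_zero] at hS'
      · refine Or.inr ⟨h1, ?_⟩
        rwa [hz t _ (left_lt hJ) (disjoint_right.1 (disjoint_toSet_left_right J) h1),
          zero_add] at hS'
    have hAl := truncPacking_nonneg α n (Interval.left J)
    have hAr := truncPacking_nonneg α n (Interval.right J)
    have hd : 0 < J.2 - J.1 := by linarith
    have hA2 := truncPacking_le_two hJ (hα2 J (self_mem_dyadic J)) (n + 1)
    have hmidJ := hmid J (self_mem_dyadic J)
    have hstep := bellman_step (l := l) hp (hα J (self_mem_dyadic J)) (hx J)
      (A := (truncPacking α n (Interval.left J) + truncPacking α n (Interval.right J)) / 2)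
      (by positivity) hA2
    have hconc := bellman_midpoint (l := l - α J * x J ^ (1 / p)) hp0 (hx (Interval.left J)) hAl
      (hx (Interval.right J)) hAr
    rw [← hmidJ] at hconc
    refine ((measure_mono hsub).trans (measure_union_le _ _)).trans
      ((add_le_add ihl ihr).trans ?_)
    rw [show (Interval.left J).2 - (Interval.left J).1 = (J.2 - J.1) / 2 by
        simp only [Interval.left]; ring,
      show (Interval.right J).2 - (Interval.right J).1 = (J.2 - J.1) / 2 by
        simp only [Interval.right]; ring,
      ← ENNReal.ofReal_add (mul_nonneg (by positivity) (bellman_nonneg hp0 (hx _) hAl))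
        (mul_nonneg (by positivity) (bellman_nonneg hp0 (hx _) hAr))]
    refine ENNReal.ofReal_le_ofReal ?_
    rw [truncPacking]
    calc _ = (J.2 - J.1) * ((bellman p (x (Interval.left J)) (truncPacking α n (Interval.left J))
            (l - α J * x J ^ (1 / p)) + bellman p (x (Interval.right J))
            (truncPacking α n (Interval.right J)) (l - α J * x J ^ (1 / p))) / 2) := by ring
      _ ≤ _ := mul_le_mul_of_nonneg_left (hconc.trans hstep) hd.le

/-! ### Averages, and passage from truncations to the full operator -/

lemma average_mul_len (g : ℝ → ℝ≥0∞) {J : Interval} (hJ : J.1 < J.2) :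
    average g J * Interval.len J = ∫⁻ t in Interval.toSet J, g t :=
  ENNReal.div_mul_cancel (len_ne_zero hJ) (len_ne_top J)

lemma average_eq_midpoint (g : ℝ → ℝ≥0∞) {J : Interval} (hJ : J.1 < J.2) :
    average g J = (average g (Interval.left J) + average g (Interval.right J)) / 2 := by
  unfold average
  rw [← toSet_left_union_right hJ, lintegral_union (measurableSet_toSet _)
    (disjoint_toSet_left_right J), len_left, len_right, ← ENNReal.add_div]
  simp only [div_eq_mul_inv]
  rw [ENNReal.mul_inv (by simp) (by simp), inv_inv, mul_assoc, mul_assoc,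
    ENNReal.mul_inv_cancel (by simp) (by simp), mul_one]

lemma average_ne_top {g : ℝ → ℝ≥0∞} {I J : Interval} (hI : I.1 < I.2) (hJ : J ∈ dyadic I)
    (hg : ∫⁻ t in Interval.toSet I, g t ≠ ∞) : average g J ≠ ∞ :=
  ENNReal.div_ne_top
    (((lintegral_mono_set (toSet_subset hI hJ)).trans_lt hg.lt_top).ne)
    (len_ne_zero (dyadic_bounds hI hJ).2.1)

lemma volume_powerMeanSparse_le {p : ℝ} (hp : 1 ≤ p) {I : Interval} (hI : I.1 < I.2)
    {α : Interval → ℕ} (hα : α ∈ carleson 2 I) {f : ℝ → ℝ}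
    (hf : ∫⁻ t in Interval.toSet I, ‖f t‖ₑ ^ p ≠ ∞) {l : ℝ} (hl : 0 < l) :
    volume {t ∈ Interval.toSet I | ENNReal.ofReal l ≤ powerMeanSparse I α p f t} ≤
      ENNReal.ofReal ((1 + growth p) ^ p * (∫⁻ t in Interval.toSet I, ‖f t‖ₑ ^ p).toReal /
        l ^ p) := by
  have hp0 : 0 < p := by linarith
  set g : ℝ → ℝ≥0∞ := fun t => ‖f t‖ₑ ^ p with hg
  set x : Interval → ℝ := fun K => (average g K).toReal with hx
  set h : ℝ → Interval → ℝ≥0∞ := fun t K =>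
      (α K : ℝ≥0∞) * ENNReal.ofReal (x K) ^ (1 / p) * (Interval.toSet K).indicator 1 t with hh
  have hQ : ∀ t, powerMeanSparse I α p f t = ∑' K : dyadic I, h t K := by
    intro t
    refine tsum_congr fun K => ?_
    simp only [hh, hx]
    rw [ENNReal.ofReal_toReal (average_ne_top hI K.2 hf)]
  have hmid : ∀ K ∈ dyadic I, x K = (x (Interval.left K) + x (Interval.right K)) / 2 := by
    intro K hK
    have hK' := dyadic_bounds hI hK
    simp only [hx]
    rw [average_eq_midpoint g hK'.2.1, ENNReal.toReal_div, ENNReal.toReal_add]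
    · simp
    · exact average_ne_top hI (dyadic_subset hK (dyadic_left_subset K (self_mem_dyadic _))) hf
    · exact average_ne_top hI (dyadic_subset hK (dyadic_right_subset K (self_mem_dyadic _))) hf
  have hxI : (I.2 - I.1) * x I = (∫⁻ t in Interval.toSet I, g t).toReal := by
    rw [← average_mul_len g hI, ENNReal.toReal_mul, Interval.len,
      ENNReal.toReal_ofReal (by linarith), mul_comm]
  -- A supremum that is at least l need not be attained by a truncation, but every smaller level l'
  -- is. The bound is continuous in l', so l' can then increase to l.
  have hlow : ∀ l' ∈ Ioo 0 l,
      volume {t ∈ Interval.toSet I | ENNReal.ofReal l ≤ powerMeanSparse I α p f t} ≤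
        ENNReal.ofReal ((1 + growth p) ^ p * (∫⁻ t in Interval.toSet I, g t).toReal / l' ^ p) := by
    rintro l' ⟨hl0, hll⟩
    have hsub : {t ∈ Interval.toSet I | ENNReal.ofReal l ≤ powerMeanSparse I α p f t} ⊆
        ⋃ n, {t ∈ Interval.toSet I | ENNReal.ofReal l' ≤ truncSum (h t) n I} := by
      rintro t ⟨ht, hle⟩
      have hlt : ENNReal.ofReal l' < ⨆ n, truncSum (h t) n I :=
        ((ENNReal.ofReal_lt_ofReal_iff hl).2 hll).trans_le
          ((hle.trans_eq (hQ t)).trans (tsum_dyadic_le_iSup _ I))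
      obtain ⟨n, hn⟩ := lt_iSup_iff.1 hlt
      exact mem_iUnion.2 ⟨n, ht, hn.le⟩
    refine (measure_mono hsub).trans ?_
    rw [Monotone.measure_iUnion]
    · refine iSup_le fun n => ?_
      have hα2 : ∀ K ∈ dyadic I, packing α K ≤ 2 := fun K hK =>
        (le_iSup₂ (f := fun J (_ : J ∈ dyadic I) => packing α J) K hK).trans hα.2
      refine (volume_truncSum_le hp α x (fun _ => ENNReal.toReal_nonneg) n hI hα.1 hα2 hmid
        l').trans (ENNReal.ofReal_le_ofReal ?_)
      refine (mul_le_mul_of_nonneg_left (bellman_le hp0 ENNReal.toReal_nonneg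
        (truncPacking_nonneg α n I) hl0) (by linarith)).trans (le_of_eq ?_)
      rw [← hxI]
      ring
    · intro n k hnk t ht
      exact ⟨ht.1, ht.2.trans (truncSum_mono (h t) I hnk)⟩
  have hcont : Filter.Tendsto (fun l' : ℝ => ENNReal.ofReal
      ((1 + growth p) ^ p * (∫⁻ t in Interval.toSet I, g t).toReal / l' ^ p)) (nhdsWithin l (Iio l))
      (nhds (ENNReal.ofReal
        ((1 + growth p) ^ p * (∫⁻ t in Interval.toSet I, g t).toReal / l ^ p))) := by
    refine ENNReal.tendsto_ofReal (Filter.Tendsto.mono_left ?_ nhdsWithin_le_nhds)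
    refine tendsto_const_nhds.div ?_ (by positivity)
    exact (Real.continuousAt_rpow_const l p (Or.inl hl.ne')).tendsto
  exact ge_of_tendsto hcont (Filter.eventually_of_mem (Ioo_mem_nhdsLT hl) hlow)

lemma eLpNorm_toSet {p : ℝ} (hp : 0 < p) (f : ℝ → ℝ) (I : Interval) :
    eLpNorm f (ENNReal.ofReal p) (volume.restrict (Interval.toSet I)) =
      (∫⁻ t in Interval.toSet I, ‖f t‖ₑ ^ p) ^ (1 / p) := by
  rw [eLpNorm_eq_lintegral_rpow_enorm_toReal (by simpa using hp) ENNReal.ofReal_ne_top,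
    ENNReal.toReal_ofReal hp.le]

lemma weakTypeNorm_powerMeanSparse_le {p : ℝ} (hp : 1 ≤ p) {I : Interval} (hI : I.1 < I.2)
    {α : Interval → ℕ} (hα : α ∈ carleson 2 I) :
    weakTypeNorm I p (powerMeanSparse I α p) ≤ ENNReal.ofReal (1 + growth p) := by
  have hp0 : 0 < p := by linarith
  have hg := growth_pos hp0
  refine sInf_le fun f hf => ?_
  have hfin : ∫⁻ t in Interval.toSet I, ‖f t‖ₑ ^ p ≠ ∞ := by
    have := hf.2
    rw [eLpNorm_toSet hp0] at this
    intro h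
    rw [h, ENNReal.top_rpow_of_pos (by positivity)] at this
    exact this.ne rfl
  rw [eLpNorm_toSet hp0]
  refine iSup₂_le fun l hl => ?_
  have hv := volume_powerMeanSparse_le hp hI hα hfin hl
  set G := ∫⁻ t in Interval.toSet I, ‖f t‖ₑ ^ p
  refine (mul_le_mul_right (ENNReal.rpow_le_rpow hv (by positivity)) _).trans (le_of_eq ?_)
  have hG : 0 ≤ G.toReal := ENNReal.toReal_nonneg
  rw [ENNReal.ofReal_rpow_of_nonneg (by positivity) (by positivity),
    ← ENNReal.ofReal_mul hl.le, ← ENNReal.ofReal_toReal hfin,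
    ENNReal.ofReal_rpow_of_nonneg hG (by positivity), ← ENNReal.ofReal_mul (by positivity),
    ENNReal.toReal_ofReal hG]
  congr 1
  rw [Real.div_rpow (by positivity) (by positivity), Real.mul_rpow (by positivity) hG, one_div,
    Real.rpow_rpow_inv (by positivity) hp0.ne', Real.rpow_rpow_inv hl.le hp0.ne']
  field_simp

/-! ### The extremal examples -/

open Classical in
/-- The sequence with value `ε` at `I` that agrees with `α` on `𝒟(I₋)` and with `β` on
`𝒟(I₊)`. -/
noncomputable def glue (I : Interval) (ε : ℕ) (α β : Interval → ℕ) (K : Interval) : ℕ :=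
  if K = I then ε else if K ∈ dyadic (Interval.left I) then α K else β K

section Glue

variable {I : Interval} {ε : ℕ} {α β : Interval → ℕ}

lemma glue_self : glue I ε α β I = ε := if_pos rfl

lemma glue_of_mem_left (hI : I.1 < I.2) {K : Interval} (hK : K ∈ dyadic (Interval.left I)) :
    glue I ε α β K = α K := by
  rw [glue, if_neg (by rintro rfl; exact not_mem_dyadic_left hI hK), if_pos hK]

lemma glue_of_mem_right (hI : I.1 < I.2) {K : Interval} (hK : K ∈ dyadic (Interval.right I)) :
    glue I ε α β K = β K := by
  rw [glue, if_neg (by rintro rfl; exact not_mem_dyadic_right hI hK),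
    if_neg (disjoint_right.1 (disjoint_dyadic_left_right hI) hK)]

lemma tsum_glue (hI : I.1 < I.2) (w : Interval → ℝ≥0∞) :
    ∑' K : dyadic I, (glue I ε α β K : ℝ≥0∞) * w K = ε * w I +
      (∑' K : dyadic (Interval.left I), (α K : ℝ≥0∞) * w K +
        ∑' K : dyadic (Interval.right I), (β K : ℝ≥0∞) * w K) := by
  rw [tsum_dyadic (fun K => (glue I ε α β K : ℝ≥0∞) * w K) hI, glue_self]
  congr 2
  · exact tsum_congr fun K => by rw [glue_of_mem_left hI K.2]
  · exact tsum_congr fun K => by rw [glue_of_mem_right hI K.2]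

/-- Gluing two Carleson sequences gives a Carleson sequence if the packing at the root is
admissible. -/
lemma glue_mem_carleson (hI : I.1 < I.2) {C : ℝ≥0∞} (hε : ε = 0 ∨ ε = 1)
    (hα : α ∈ carleson C (Interval.left I)) (hβ : β ∈ carleson C (Interval.right I))
    (h : packing (glue I ε α β) I ≤ C) : glue I ε α β ∈ carleson C I := by
  have hsplit : ∀ J ∈ dyadic I,
      J = I ∨ J ∈ dyadic (Interval.left I) ∨ J ∈ dyadic (Interval.right I) := by
    intro J hJ
    rwa [dyadic_eq] at hJ
  refine ⟨fun J hJ => ?_, iSup₂_le fun J hJ => ?_⟩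
  · rcases hsplit J hJ with rfl | hJ | hJ
    · rwa [glue_self]
    · rw [glue_of_mem_left hI hJ]; exact hα.1 J hJ
    · rw [glue_of_mem_right hI hJ]; exact hβ.1 J hJ
  · rcases hsplit J hJ with rfl | hJ | hJ
    · exact h
    · refine le_of_eq_of_le ?_ ((le_iSup₂ (f := fun J (_ : J ∈ dyadic (Interval.left I)) =>
        packing α J) J hJ).trans hα.2)
      exact congrArg (· / Interval.len J)
        (tsum_congr fun K => by rw [glue_of_mem_left hI (dyadic_subset hJ K.2)])
    · refine le_of_eq_of_le ?_ ((le_iSup₂ (f := fun J (_ : J ∈ dyadic (Interval.right I)) =>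
        packing β J) J hJ).trans hβ.2)
      exact congrArg (· / Interval.len J)
        (tsum_congr fun K => by rw [glue_of_mem_right hI (dyadic_subset hJ K.2)])

lemma packing_glue (hI : I.1 < I.2) :
    packing (glue I ε α β) I =
      ε + (packing α (Interval.left I) + packing β (Interval.right I)) / 2 := by
  unfold packing
  rw [tsum_glue hI Interval.len, len_left, len_right, ← ENNReal.add_div, ENNReal.add_div,
    ENNReal.mul_div_cancel_right (len_ne_zero hI) (len_ne_top I)]
  congr 1
  simp only [div_eq_mul_inv]
  rw [ENNReal.mul_inv (by simp) (by simp), inv_inv, mul_assoc, mul_assoc,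
    ENNReal.mul_inv_cancel (by simp) (by simp), mul_one]

end Glue

/-! ### The extremal sequences and their test functions -/

lemma zero_mem_carleson (C : ℝ≥0∞) (I : Interval) : (fun _ => 0) ∈ carleson C I := by
  refine ⟨fun _ _ => Or.inl rfl, iSup₂_le fun J _ => ?_⟩
  simp [packing]

lemma packing_zero (I : Interval) : packing (fun _ => 0) I = 0 := by
  simp [packing]

/-- The sequence equal to `1` at `I` and `0` elsewhere. -/
noncomputable def single (I : Interval) : Interval → ℕ := glue I 1 (fun _ => 0) (fun _ => 0)

lemma packing_single {I : Interval} (hI : I.1 < I.2) : packing (single I) I = 1 := by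
  rw [single, packing_glue hI, packing_zero, packing_zero]
  simp

lemma single_mem_carleson {I : Interval} (hI : I.1 < I.2) : single I ∈ carleson 2 I :=
  glue_mem_carleson hI (Or.inr rfl) (zero_mem_carleson _ _) (zero_mem_carleson _ _)
    ((packing_single hI).le.trans (by norm_num))

lemma tsum_single {I : Interval} (hI : I.1 < I.2) (w : Interval → ℝ≥0∞) :
    ∑' K : dyadic I, (single I K : ℝ≥0∞) * w K = w I := by
  rw [single, tsum_glue hI]
  simp

/-- The root, its left descendants down to generation `n`, and the two children of the last. -/
noncomputable def chain : ℕ → Interval → Interval → ℕ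
  | 0, I => glue I 1 (single (Interval.left I)) (single (Interval.right I))
  | n + 1, I => glue I 1 (chain n (Interval.left I)) (fun _ => 0)

/-- The packing 2 reproduces itself: 1 + (2 + 0)/2 = 2 along the chain, starting from 1 + (1 + 1)/2
= 2 at its end. -/
lemma packing_chain (n : ℕ) {I : Interval} (hI : I.1 < I.2) : packing (chain n I) I = 2 := by
  induction n generalizing I with
  | zero =>
    rw [chain, packing_glue hI, packing_single (left_lt hI), packing_single (right_lt hI),
      one_add_one_eq_two, ENNReal.div_self (by simp) (by simp), Nat.cast_one, one_add_one_eq_two]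
  | succ n ih =>
    rw [chain, packing_glue hI, ih (left_lt hI), packing_zero, add_zero,
      ENNReal.div_self (by simp) (by simp), Nat.cast_one, one_add_one_eq_two]

lemma chain_mem_carleson (n : ℕ) {I : Interval} (hI : I.1 < I.2) : chain n I ∈ carleson 2 I := by
  induction n generalizing I with
  | zero =>
    exact glue_mem_carleson hI (Or.inr rfl) (single_mem_carleson (left_lt hI))
      (single_mem_carleson (right_lt hI)) (packing_chain 0 hI).le
  | succ n ih =>
    exact glue_mem_carleson hI (Or.inr rfl) (ih (left_lt hI)) (zero_mem_carleson _ _)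
      (packing_chain (n + 1) hI).le

/-- The leftmost interval of generation `n`. -/
noncomputable def leftmost : ℕ → Interval → Interval
  | 0, I => I
  | n + 1, I => leftmost n (Interval.left I)

lemma leftmost_mem_dyadic (n : ℕ) (I : Interval) : leftmost n I ∈ dyadic I := by
  induction n generalizing I with
  | zero => exact self_mem_dyadic I
  | succ n ih => exact dyadic_left_subset I (ih _)

lemma len_leftmost (n : ℕ) (I : Interval) :
    Interval.len (leftmost n I) = Interval.len I * ENNReal.ofReal ((1 / 2) ^ n) := by
  induction n generalizing I with
  | zero => simp [leftmost]
  | succ n ih =>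
    rw [leftmost, ih, len_left, pow_succ, ENNReal.ofReal_mul (by positivity), div_eq_mul_inv,
      ENNReal.ofReal_div_of_pos two_pos]
    simp only [ENNReal.ofReal_one, ENNReal.ofReal_ofNat, one_div]
    ring

/-- The value of the sparse operator at the extremal example. -/
noncomputable def chainConst (r : ℝ) (n : ℕ) : ℝ :=
  1 + ∑ k ∈ Finset.range (n + 1), ((1 / 2 : ℝ) ^ r) ^ k

lemma chainConst_nonneg (r : ℝ) (n : ℕ) : 0 ≤ chainConst r n := by
  unfold chainConst; positivity

lemma average_indicator {E J : Interval} (hE : Interval.toSet E ⊆ Interval.toSet J) :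
    average ((Interval.toSet E).indicator 1) J = Interval.len E / Interval.len J := by
  unfold average
  rw [lintegral_indicator_one (measurableSet_toSet E),
    Measure.restrict_apply (measurableSet_toSet E), inter_eq_left.2 hE]
  congr 1
  exact Real.volume_Ico

lemma average_leftmost (n : ℕ) {I : Interval} (hI : I.1 < I.2) :
    average ((Interval.toSet (leftmost n I)).indicator 1) I = ENNReal.ofReal ((1 / 2) ^ n) := by
  rw [average_indicator (toSet_subset hI (leftmost_mem_dyadic n I)), len_leftmost, mul_comm,
    ENNReal.mul_div_cancel_right (len_ne_zero hI) (len_ne_top I)]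

/-- The terminal interval contributes 1 and its two children together another 1, since exactly one
of them contains `t`. Each step up the chain halves the average and adds the next term of the
geometric sum. -/
lemma chainConst_le_tsum {r : ℝ} (hr : 0 ≤ r) (n : ℕ) {I : Interval} (hI : I.1 < I.2) {t : ℝ}
    (ht : t ∈ Interval.toSet (leftmost n I)) :
    ENNReal.ofReal (chainConst r n) ≤ ∑' K : dyadic I, (chain n I K : ℝ≥0∞) *
      (average ((Interval.toSet (leftmost n I)).indicator 1) K ^ r *
        (Interval.toSet K).indicator 1 t) := by
  induction n generalizing I with
  | zero =>
    have hone : ∀ K : Interval, K.1 < K.2 → Interval.toSet K ⊆ Interval.toSet I →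
        average ((Interval.toSet I).indicator 1) K = 1 := by
      intro K hK hKI
      unfold average
      rw [setLIntegral_congr_fun (measurableSet_toSet K) (g := 1)
        (fun s hs => indicator_of_mem (hKI hs) _)]
      simp only [Pi.one_apply, lintegral_one, Measure.restrict_apply_univ]
      rw [show volume (Interval.toSet K) = Interval.len K from Real.volume_Ico]
      exact ENNReal.div_self (len_ne_zero hK) (len_ne_top K)
    have hl := toSet_subset hI (dyadic_left_subset I (self_mem_dyadic _))
    have hr' := toSet_subset hI (dyadic_right_subset I (self_mem_dyadic _))
    have ht' : t ∈ Interval.toSet I := ht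
    have hsum : (Interval.toSet (Interval.left I)).indicator (1 : ℝ → ℝ≥0∞) t +
        (Interval.toSet (Interval.right I)).indicator (1 : ℝ → ℝ≥0∞) t = 1 := by
      have := congrFun (indicator_union_of_disjoint (disjoint_toSet_left_right I)
        (1 : ℝ → ℝ≥0∞)) t
      rw [toSet_left_union_right hI, indicator_of_mem ht', Pi.one_apply] at this
      exact this.symm
    rw [chain, leftmost, tsum_glue hI fun K => average ((Interval.toSet I).indicator 1) K ^ r *
      (Interval.toSet K).indicator 1 t,
      tsum_single (left_lt hI) fun K => average ((Interval.toSet I).indicator 1) K ^ r *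
      (Interval.toSet K).indicator 1 t,
      tsum_single (right_lt hI) fun K => average ((Interval.toSet I).indicator 1) K ^ r *
      (Interval.toSet K).indicator 1 t, hone I hI subset_rfl, hone _ (left_lt hI) hl,
      hone _ (right_lt hI) hr', ENNReal.one_rpow, one_mul, one_mul, one_mul, hsum,
      indicator_of_mem ht']
    simp [chainConst, one_add_one_eq_two]
  | succ n ih =>
    have ht' : t ∈ Interval.toSet I := toSet_subset hI (leftmost_mem_dyadic (n + 1) I) ht
    rw [chain, tsum_glue hI fun K =>
      average ((Interval.toSet (leftmost (n + 1) I)).indicator 1) K ^ r *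
      (Interval.toSet K).indicator 1 t, average_leftmost (n + 1) hI, indicator_of_mem ht']
    -- The root supplies the last term of the geometric sum, the left half all the others.
    have h1 : ENNReal.ofReal (chainConst r (n + 1)) =
        ENNReal.ofReal ((1 / 2) ^ (n + 1)) ^ r + ENNReal.ofReal (chainConst r n) := by
      rw [ENNReal.ofReal_rpow_of_nonneg (by positivity) hr,
        ← ENNReal.ofReal_add (by positivity) (chainConst_nonneg r n)]
      congr 1
      rw [chainConst, chainConst, Finset.sum_range_succ, ← Real.rpow_pow_comm (by norm_num)]
      ring
    rw [h1]
    have h2 := ih (left_lt hI) ht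
    simp only [Nat.cast_one, one_mul, Pi.one_apply, mul_one]
    gcongr
    exact h2.trans le_self_add

lemma chainConst_le_weakTypeNorm {p : ℝ} (hp : 1 ≤ p) {I : Interval} (hI : I.1 < I.2) (n : ℕ) :
    ENNReal.ofReal (chainConst (1 / p) n) ≤
      weakTypeNorm I p (powerMeanSparse I (chain n I) p) := by
  have hp0 : 0 < p := by linarith
  refine le_sInf fun c hc => ?_
  set E := leftmost n I with hE
  have hEI := toSet_subset hI (leftmost_mem_dyadic n I)
  have hE0 := (dyadic_bounds hI (leftmost_mem_dyadic n I)).2.1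
  have hg : (fun s => ‖(Interval.toSet E).indicator (1 : ℝ → ℝ) s‖ₑ ^ p) =
      (Interval.toSet E).indicator 1 := by
    funext s
    by_cases hs : s ∈ Interval.toSet E
    · simp [hs]
    · simp [hs, hp0]
  have hvol : volume (Interval.toSet E) = Interval.len E := Real.volume_Ico
  have hint : ∫⁻ t in Interval.toSet I, ‖(Interval.toSet E).indicator (1 : ℝ → ℝ) t‖ₑ ^ p =
      Interval.len E := by
    rw [hg, lintegral_indicator_one (measurableSet_toSet E),
      Measure.restrict_apply (measurableSet_toSet E), inter_eq_left.2 hEI, hvol]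
  have hmem : MemLp ((Interval.toSet E).indicator (1 : ℝ → ℝ)) (ENNReal.ofReal p)
      (volume.restrict (Interval.toSet I)) := by
    refine ⟨(measurable_one.indicator (measurableSet_toSet E)).aestronglyMeasurable, ?_⟩
    rw [eLpNorm_toSet hp0, hint]
    exact ENNReal.rpow_lt_top_of_nonneg (by positivity) (len_ne_top E)
  have hw := hc _ hmem
  rw [eLpNorm_toSet hp0, hint] at hw
  have hpos : 0 < chainConst (1 / p) n := by unfold chainConst; positivity
  have hlow := (le_iSup₂ (f := fun (l : ℝ) (_ : 0 < l) => ENNReal.ofReal l *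
    volume {t ∈ Interval.toSet I | ENNReal.ofReal l ≤ powerMeanSparse I (chain n I) p
      ((Interval.toSet E).indicator 1) t} ^ (1 / p)) _ hpos).trans hw
  have hsub : Interval.toSet E ⊆ {t ∈ Interval.toSet I | ENNReal.ofReal (chainConst (1 / p) n) ≤
      powerMeanSparse I (chain n I) p ((Interval.toSet E).indicator 1) t} := by
    intro t ht
    refine ⟨hEI ht, (chainConst_le_tsum (by positivity) n hI ht).trans (le_of_eq ?_)⟩
    unfold powerMeanSparse
    rw [hg]
    exact tsum_congr fun K => (mul_assoc _ _ _).symm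
  have hfin := (mul_le_mul_right (ENNReal.rpow_le_rpow (measure_mono (μ := volume) hsub)
    (show 0 ≤ 1 / p by positivity)) (ENNReal.ofReal (chainConst (1 / p) n))).trans hlow
  rw [hvol] at hfin
  -- The norm of the test function is |E|^{1/p}, the same factor as on the left, and it is neither 0
  -- nor infinite.
  refine (ENNReal.mul_le_mul_iff_left ?_ ?_).1 hfin
  · exact (ENNReal.rpow_pos (pos_iff_ne_zero.2 (len_ne_zero hE0)) (len_ne_top E)).ne'
  · exact ENNReal.rpow_ne_top_of_nonneg (by positivity) (len_ne_top E)

/-! ### Evaluation of the sharp constant -/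

lemma tendsto_chainConst {p : ℝ} (hp : 0 < p) :
    Filter.Tendsto (chainConst (1 / p)) Filter.atTop (nhds (1 + growth p)) := by
  have h2 := one_lt_two_rpow hp
  have hq : (1 / 2 : ℝ) ^ (1 / p) = (2 ^ (1 / p))⁻¹ := by
    rw [one_div (2 : ℝ), Real.inv_rpow (by norm_num)]
  have hs := hasSum_geometric_of_lt_one (r := (1 / 2 : ℝ) ^ (1 / p)) (by positivity)
    (hq ▸ inv_lt_one_of_one_lt₀ h2)
  have hgr : (1 - (1 / 2 : ℝ) ^ (1 / p))⁻¹ = growth p := by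
    have h3 : (2 : ℝ) ^ (1 / p) - 1 ≠ 0 := by linarith
    rw [hq, growth]
    field_simp
  rw [hgr] at hs
  exact ((Filter.tendsto_add_atTop_iff_nat 1).2 hs.tendsto_sum_nat).const_add 1

lemma one_add_growth {p : ℝ} (hp : 0 < p) :
    1 + growth p = (2 * (2 : ℝ) ^ (1 / p) - 1) / ((2 : ℝ) ^ (1 / p) - 1) := by
  have h2 := one_lt_two_rpow hp
  have h3 : (2 : ℝ) ^ (1 / p) - 1 ≠ 0 := by linarith
  rw [growth]
  field_simp
  ring

lemma sharpConst_rpow {p : ℝ} (hp : 0 < p) :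
    sharpConst (1 / p) ^ (1 / p) =
      (2 * (2 : ℝ) ^ (1 / p) - 1) / ((2 : ℝ) ^ (1 / p) - 1) := by
  have h2 := one_lt_two_rpow hp
  rw [sharpConst, one_div_one_div, Real.rpow_add two_pos, Real.rpow_one, mul_comm _ (2 : ℝ),
    one_div, Real.rpow_rpow_inv _ hp.ne']
  rw [← one_div]
  exact div_nonneg (by linarith) (by linarith)

end PowerMeanSparse

theorem mainTheorem3 (a b : ℝ) (hab : a < b) (p : ℝ) (hp : 1 ≤ p) :
    (⨆ α ∈ PowerMeanSparse.carleson 2 (a, b),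
        PowerMeanSparse.weakTypeNorm (a, b) p
          (PowerMeanSparse.powerMeanSparse (a, b) α p)) =
      ENNReal.ofReal (PowerMeanSparse.sharpConst (1 / p) ^ (1 / p)) ∧
    PowerMeanSparse.sharpConst (1 / p) ^ (1 / p) =
      (2 * (2 : ℝ) ^ (1 / p) - 1) / ((2 : ℝ) ^ (1 / p) - 1) := by
  have hp0 : 0 < p := by linarith
  have hc := PowerMeanSparse.sharpConst_rpow hp0
  refine ⟨?_, hc⟩
  rw [hc, ← PowerMeanSparse.one_add_growth hp0]
  refine le_antisymm
    (iSup₂_le fun α hα => PowerMeanSparse.weakTypeNorm_powerMeanSparse_le hp hab hα) ?_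
  refine le_of_tendsto' (ENNReal.tendsto_ofReal (PowerMeanSparse.tendsto_chainConst hp0))
    fun n => ?_
  exact (PowerMeanSparse.chainConst_le_weakTypeNorm hp hab n).trans
    (le_iSup₂ (f := fun α (_ : α ∈ PowerMeanSparse.carleson 2 (a, b)) =>
      PowerMeanSparse.weakTypeNorm (a, b) p (PowerMeanSparse.powerMeanSparse (a, b) α p)) _
      (PowerMeanSparse.chain_mem_carleson n hab))
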